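/- All rings are unital, and $\mathbb{Q}\langle y,\bar y\rangle$ denotes the ring of polynomials over $\mathbb{Q}$ in two non-commuting variables $y,\bar y$. For $\mathbb{Q}$-algebras $A,B$, let $A\ast_{\mathbb{Q}}B$ be their free product over $\mathbb{Q}$: the coproduct of $A$ and $B$ in the category of unital associative $\mathbb{Q}$-algebras, where moreover the canonical maps $A\to A\ast_{\mathbb{Q}}B$ and $B\to A\ast_{\mathbb{Q}}B$ are required to be injective with images intersecting exactly in $\mathbb{Q}$ (when these two conditions hold, one says that the free product exists). **(1)** Let $f(t)\in\mathbb{Q}[t]$ be a non-constant polynomial with non-zero constant term, let $$R_f=\mathbb{Q}\langle y,\bar y\rangle/\langle f(y\bar y),\,f(\bar y y)\rangle$$ be the quotient by the two-sided ideal generated by $f(y\bar y)$ and $f(\bar y y)$, and let $K=\mathbb{Q}[t]/\langle f(t)\rangle$. Then the free product $\mathbb{Q}[x,x^{-1}]\ast_{\mathbb{Q}}K$ of the Laurent polynomial ring $\mathbb{Q}[x,x^{-1}]$ and $K$ exists, and $$R_f\;\cong\;\mathbb{Q}[x,x^{-1}]\ast_{\mathbb{Q}}K .$$ If $f(t)$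 is irreducible, then $R_f$ is a domain. **(2)** Let $(W,S)$ be a Coxeter system with generators $S=\{s_1,\dots,s_N\}$ and Coxeter matrix $(m_{ij})_{1\le i,j\le N}$. Let $\Gamma_{W,S}$ be the graph with vertices $s_1,\dots,s_N$ and oriented edges $Y=\{y_{ij}=[s_is_j] : i\neq j,\ 3\le m_{ij}\le\infty\}$, with $\overline{y_{ij}}=y_{ji}$, and let $Y=Y_+\sqcup\overline{Y_+}$ be an orientation of it. For $m\ge 3$ let $C_m(t)$ be the minimal polynomial over $\mathbb{Q}$ of $4\cos^2(\pi/m)$. For $y_{ij}\in Y_+$ put $$R_{y_{ij}}=\begin{cases}\mathbb{Q}\langle x,\bar x\rangle & \text{if } m_{ij}=\infty,\\ \mathbb{Q}\langle x,\bar x\rangle/\langle C_{m_{ij}}(x\bar x),\,C_{m_{ij}}(\bar x x)\rangle & \text{if } m_{ij}<\infty.\end{cases}$$ Then for every $y_{ij}\in Y_+$: - if $m_{ij}=\infty$, then $R_{y_{ij}}\cong\mathbb{Q}\langle x,\bar x\rangle$; - if $m_{ij}<\infty$, then $K=\mathbb{Q}[t]/\langle C_{m_{ij}}(t)\rangle$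 is a field, the free product $\mathbb{Q}[x,x^{-1}]\ast_{\mathbb{Q}}K$ exists, and $R_{y_{ij}}\cong\mathbb{Q}[x,x^{-1}]\ast_{\mathbb{Q}}K$; - in all cases $R_{y_{ij}}$ is a domain. -/

import Mathlib

noncomputable section

namespace EdgeRings

open Polynomial

/-! ### The rings `R_f` -/

/-- The ring `ℚ⟨y, ȳ⟩` of polynomials in two non-commuting variables. -/
abbrev NCPoly : Type := FreeAlgebra ℚ (Fin 2)

/-- The variable `y`. -/
def y : NCPoly := FreeAlgebra.ι ℚ 0

/-- The variable `ȳ`. -/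
def yBar : NCPoly := FreeAlgebra.ι ℚ 1

/-- The two-sided ideal `⟨f(y ȳ), f(ȳ y)⟩` of `ℚ⟨y, ȳ⟩`. -/
def polyIdeal (f : ℚ[X]) : TwoSidedIdeal NCPoly :=
  TwoSidedIdeal.span {aeval (y * yBar) f, aeval (yBar * y) f}

/-- The quotient ring `R_f = ℚ⟨y, ȳ⟩ / ⟨f(y ȳ), f(ȳ y)⟩`. -/
abbrev PolyRing (f : ℚ[X]) : Type := (polyIdeal f).ringCon.Quotient

/-! ### The free product over `ℚ` of two `ℚ`-algebras -/

/-- The family consisting of the two rings `A` and `B`. -/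
def Factor (A B : Type) : Bool → Type
  | false => A
  | true => B

instance (A B : Type) [Ring A] [Ring B] : ∀ b : Bool, Ring (Factor A B b)
  | false => inferInstanceAs (Ring A)
  | true => inferInstanceAs (Ring B)

instance (A B : Type) [Ring A] [Ring B] [Algebra ℚ A] [Algebra ℚ B] :
    ∀ b : Bool, Algebra ℚ (Factor A B b)
  | false => inferInstanceAs (Algebra ℚ A)
  | true => inferInstanceAs (Algebra ℚ B)

variable (A B : Type) [Ring A] [Ring B] [Algebra ℚ A] [Algebra ℚ B]

/-- The universal product (coproduct of `ℚ`-algebras) `A ∗_ℚ B`. -/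
abbrev FreeProd : Type := LinearAlgebra.FreeProduct ℚ (Factor A B)

/-- The canonical homomorphism `A → A ∗_ℚ B`. -/
def inl : A →ₐ[ℚ] FreeProd A B := LinearAlgebra.FreeProduct.ι ℚ (Factor A B) false

/-- The canonical homomorphism `B → A ∗_ℚ B`. -/
def inr : B →ₐ[ℚ] FreeProd A B := LinearAlgebra.FreeProduct.ι ℚ (Factor A B) true

/-- The universal product `A ∗_ℚ B` is a free product in the strict sense: `A` and `B` are
subrings of it (via the canonical homomorphisms) and these subrings intersect in `ℚ`. -/
structure IsStrictFreeProd : Prop where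
  inl_injective : Function.Injective (inl A B)
  inr_injective : Function.Injective (inr A B)
  range_inf_range : (inl A B).range ⊓ (inr A B).range = ⊥

/-! ### The graph of a Coxeter system and its edge rings -/

/-- The graph `Γ_{W,S}`: its vertices are (the indices of) the simple generators, and `i ≠ j` are
joined if `m i j ≥ 3`. In Mathlib's Coxeter matrices the entry `0` stands for `∞`. The oriented
edges `[s_i s_j]` are the darts of this graph, and `y ↦ ȳ` is `SimpleGraph.Dart.symm`. -/
def coxeterGraph {I : Type*} (M : CoxeterMatrix I) : SimpleGraph I where
  Adj i j := i ≠ j ∧ (M i j = 0 ∨ 3 ≤ M i j)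
  symm := ⟨fun i j h => ⟨h.1.symm, by rw [M.symmetric j i]; exact h.2⟩⟩
  loopless := ⟨fun _ h => h.1 rfl⟩

/-- An orientation of a graph: a set `Y₊` of oriented edges such that the set of all oriented
edges is the disjoint union of `Y₊` and the set of reversals of members of `Y₊`. -/
def IsOrientation {V : Type*} {G : SimpleGraph V} (Ypos : Set G.Dart) : Prop :=
  IsCompl Ypos (SimpleGraph.Dart.symm '' Ypos)

/-- `C_m(t)`, the minimal polynomial over `ℚ` of `4 cos² (π / m)`. -/
def C (m : ℕ) : ℚ[X] := minpoly ℚ (4 * Real.cos (Real.pi / m) ^ 2)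

/-- The ideal of relations of the ring attached to an edge with label `m` (`0` stands for `∞`). -/
def edgeIdeal (m : ℕ) : TwoSidedIdeal NCPoly :=
  if m = 0 then ⊥ else polyIdeal (C m)

/-- The ring `R_y` attached to the oriented edge `y = [s_i s_j]`: it is `ℚ⟨x, x̄⟩` (no relations)
if `m i j = ∞`, and `ℚ⟨x, x̄⟩ / ⟨C_m(x x̄), C_m(x̄ x)⟩` if `m = m i j < ∞`. -/
abbrev EdgeRing {I : Type*} (M : CoxeterMatrix I) (e : (coxeterGraph M).Dart) : Type :=
  (edgeIdeal (M e.fst e.snd)).ringCon.Quotient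

end EdgeRings

end

/-! In `R_f` the elements `y ȳ` and `ȳ y` are roots of `f`, hence units because `f(0) ≠ 0`. So `y`
is a unit, and `y ↦ x`, `ȳ ↦ x⁻¹ t` is an isomorphism onto `ℚ[x, x⁻¹] ∗ K` with inverse `x ↦ y`, `t
↦ y ȳ` (`polyRingEquiv`). The free product is strict because it maps to the tensor product, in which
both factors embed and meet in `ℚ` (`isStrictFreeProd`).

The main point is that `ℚ[x, x⁻¹] ∗ K` has no zero divisors when `K` is a field. As in Magnus's
embedding of free groups, `x` is sent to `1 + z`, where `z` is a formal variable not commuting with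
`K`. For a finite basis `b` of `K` with `b i₀ = 1`, a series is a family of right coefficients in
`K` indexed by the words `b i₁ z ⋯ b iᵣ z`. Comparing terms of least length shows that a product of
nonzero series is nonzero (`star_ne_zero`). The algebra acts on series from the left, and this
action commutes with right multiplications (`map_star`), so `a ↦ a · 1` (`toSeries`) is
multiplicative.

It remains to see that this map is injective. Every element is a sum of products of syllables `κ (b
i) u ^ n`, `n ≠ 0`, followed by an element of `K` (`exists_mem_normalForms`). Nonzero powers of `1 +
z` are linearly independent modulo constants, so the coefficients at words with the most syllables
detect the longest part of a normal form (`mem_normalForms_of_toSeries`). An element with zero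
series thus loses its syllables one at a time until it is `0`.

For edge rings, `C_m` is irreducible as a minimal polynomial, and its constant term is nonzero
because `cos (π / m) ≠ 0` for `m ≥ 3`. -/

noncomputable section

namespace EdgeRings

open Polynomial

/-! ### Series in a variable not commuting with `K` -/

section Series

variable {F K ι : Type*} [Field F] [Field K] [Algebra F K]

/-- A nonzero series has a nonzero coefficient of minimal length. -/
theorem exists_leading {v : List ι → K} (hv : v ≠ 0) :
    ∃ w, v w ≠ 0 ∧ ∀ w', w'.length < w.length → v w' = 0 := by
  classical
  have h : ∃ n, ∃ w : List ι, w.length = n ∧ v w ≠ 0 := by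
    obtain ⟨w, hw⟩ := Function.ne_iff.1 hv
    exact ⟨_, w, rfl, hw⟩
  obtain ⟨w, hw, hw'⟩ := Nat.find_spec h
  refine ⟨w, hw', fun u hu => ?_⟩
  by_contra hne
  exact Nat.find_min h (hw ▸ hu) ⟨u, rfl, hne⟩

section Action

variable [Fintype ι] [DecidableEq ι] (b : Module.Basis ι F K)

/-- A function `v : List ι → K` stands for the series `∑ b i₁ z b i₂ z ⋯ b iᵣ z · v [i₁, …, iᵣ]` in a
variable `z` that does not commute with `K`. This is multiplication of such series by an element
of `K` from the left. -/
def leftMulₗ (k : K) : (List ι → K) →ₗ[F] (List ι → K) where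
  toFun v
    | [] => k * v []
    | j :: w => ∑ i, Algebra.leftMulMatrix b k j i • v (i :: w)
  map_add' v v' := by
    ext w
    cases w <;> simp [mul_add, Finset.sum_add_distrib]
  map_smul' c v := by
    ext w
    cases w
    · simp
    · simp [Finset.smul_sum, smul_comm c]

@[simp] theorem leftMulₗ_nil (k : K) (v : List ι → K) : leftMulₗ b k v [] = k * v [] := rfl

@[simp] theorem leftMulₗ_cons (k : K) (v : List ι → K) (j : ι) (w : List ι) :
    leftMulₗ b k v (j :: w) = ∑ i, Algebra.leftMulMatrix b k j i • v (i :: w) := rfl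

/-- The left action of `K` on series, as an algebra homomorphism. -/
def leftAct : K →ₐ[F] Module.End F (List ι → K) :=
  AlgHom.ofLinearMap
    { toFun := leftMulₗ b
      map_add' := fun k l => by
        ext v w
        cases w <;> simp [add_mul, add_smul, Finset.sum_add_distrib]
      map_smul' := fun c k => by
        ext v w
        cases w <;> simp [Finset.smul_sum, mul_smul] }
    (by
      ext v w
      cases w <;> simp [Matrix.one_apply])
    (fun k l => by
      ext v w
      cases w with
      | nil => simp [mul_assoc]
      | cons j w =>
        simp only [LinearMap.coe_mk, AddHom.coe_mk, leftMulₗ_cons, map_mul, Matrix.mul_apply,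
          Module.End.mul_apply, Finset.sum_smul, Finset.smul_sum, smul_smul]
        exact Finset.sum_comm)

@[simp] theorem leftAct_nil (k : K) (v : List ι → K) : leftAct b k v [] = k * v [] := rfl

theorem leftAct_cons (k : K) (v : List ι → K) (j : ι) (w : List ι) :
    leftAct b k v (j :: w) = ∑ i, Algebra.leftMulMatrix b k j i • v (i :: w) := rfl

/-- Left multiplication by `K` only mixes first letters, so it preserves word length. -/
theorem leftAct_apply_eq_zero (k : K) {v : List ι → K} {n : ℕ}
    (hv : ∀ w, w.length < n → v w = 0) (w : List ι) (hw : w.length < n) :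
    leftAct b k v w = 0 := by
  cases w with
  | nil => simp [hv [] hw]
  | cons j w =>
    rw [leftAct_cons]
    exact Finset.sum_eq_zero fun i _ => by rw [hv (i :: w) (by simpa using hw), smul_zero]

/-- Multiplication of series. -/
def star (s v : List ι → K) : List ι → K
  | [] => s [] * v []
  | i :: w => leftAct b (s []) v (i :: w) + star (fun w' => s (i :: w')) v w

theorem star_nil (s v : List ι → K) : star b s v [] = s [] * v [] := by rw [star]

theorem star_cons (s v : List ι → K) (i : ι) (w : List ι) :
    star b s v (i :: w) = leftAct b (s []) v (i :: w) + star b (fun w' => s (i :: w')) v w := by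
  rw [star]

/-- Multiplication by a series from the right. -/
def starRight (v : List ι → K) : Module.End F (List ι → K) where
  toFun s := star b s v
  map_add' s s' := by
    ext w
    induction w generalizing s s' with
    | nil => simp [star_nil, add_mul]
    | cons i w ih =>
      have := ih (fun w' => s (i :: w')) (fun w' => s' (i :: w'))
      simp only [star_cons, Pi.add_apply, map_add, LinearMap.add_apply] at this ⊢
      rw [add_add_add_comm, ← this]
      rfl
  map_smul' c s := by
    ext w
    induction w generalizing s with
    | nil => simp [star_nil]
    | cons i w ih =>
      have := ih (fun w' => s (i :: w'))
      simp only [star_cons, Pi.smul_apply, map_smul, LinearMap.smul_apply, smul_add,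
        RingHom.id_apply] at this ⊢
      rw [← this]
      rfl

@[simp] theorem starRight_apply (s v : List ι → K) : starRight b v s = star b s v := rfl

@[simp] theorem zero_star (v : List ι → K) : star b 0 v = 0 := (starRight b v).map_zero

/-- This instance of associativity makes right multiplications commute with the action of `K`;
`star_onePlus` does the same for `1 + z`. -/
theorem star_leftAct (k : K) (s v : List ι → K) :
    star b (leftAct b k s) v = leftAct b k (star b s v) := by
  ext w
  cases w with
  | nil => simp [star_nil, mul_assoc]
  | cons j w =>
    have h : (fun w' => leftAct b k s (j :: w')) =
        ∑ i, Algebra.leftMulMatrix b k j i • fun w' => s (i :: w') := by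
      ext w'
      simp [leftAct_cons, Finset.sum_apply]
    rw [star_cons, h, ← starRight_apply, map_sum]
    simp only [map_smul, starRight_apply, Finset.sum_apply, Pi.smul_apply, leftAct_nil]
    rw [leftAct_cons b k]
    simp only [star_cons, smul_add, Finset.sum_add_distrib]
    rw [map_mul, Module.End.mul_apply, leftAct_cons b k]

theorem star_apply_eq_zero (s : List ι → K) {v : List ι → K} {n : ℕ}
    (hv : ∀ w, w.length < n → v w = 0) (w : List ι) (hw : w.length < n) :
    star b s v w = 0 := by
  induction w generalizing s with
  | nil => simp [star_nil, hv [] hw]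
  | cons i w ih =>
    rw [star_cons, leftAct_apply_eq_zero b _ hv _ hw, ih _ (by simp at hw; omega), add_zero]

/-- The leading coefficients of a product. -/
theorem star_append {s v : List ι → K} {m n : ℕ} (hs : ∀ w, w.length < m → s w = 0)
    (hv : ∀ w, w.length < n → v w = 0) {w w' : List ι} (hw : w.length = m) (hw' : w'.length = n) :
    star b s v (w ++ w') = leftAct b (s w) v w' := by
  induction w generalizing s m with
  | nil =>
    cases w' with
    | nil => simp [star_nil]
    | cons i w' =>
      rw [List.nil_append, star_cons,
        star_apply_eq_zero b _ hv w' (by simp at hw'; omega), add_zero]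
  | cons i w ih =>
    rw [List.cons_append, star_cons, hs [] (by simp at hw ⊢; omega), map_zero,
      LinearMap.zero_apply, Pi.zero_apply, zero_add]
    exact ih (m := w.length) (fun u hu => hs _ (by simp at hw ⊢; omega)) rfl

/-- The series ring has no zero divisors. -/
theorem star_ne_zero {s v : List ι → K} (hs : s ≠ 0) (hv : v ≠ 0) : star b s v ≠ 0 := by
  obtain ⟨w, hw, hmin⟩ := exists_leading hs
  have hne : leftAct b (s w) v ≠ 0 := by
    intro h
    apply hv
    have := congrArg (leftAct b (s w)⁻¹) h
    rwa [← Module.End.mul_apply, ← map_mul, inv_mul_cancel₀ hw, map_one, Module.End.one_apply,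
      map_zero] at this
  obtain ⟨u, hu, humin⟩ := exists_leading hne
  -- Multiplying back by `(s w)⁻¹` shows that `v` has no terms shorter than `u` either.
  have hv' : ∀ w', w'.length < u.length → v w' = 0 := by
    intro w' hw'
    have := leftAct_apply_eq_zero b (s w)⁻¹ humin w' hw'
    rwa [← Module.End.mul_apply, ← map_mul, inv_mul_cancel₀ hw, map_one,
      Module.End.one_apply] at this
  intro h
  apply hu
  rw [← star_append b hmin hv' rfl rfl, h, Pi.zero_apply]

/-- The series `1`. -/
def oneSeries : List ι → K
  | [] => 1
  | _ :: _ => 0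

theorem oneSeries_star (v : List ι → K) : star b oneSeries v = v := by
  ext w
  cases w with
  | nil => simp [star_nil, oneSeries]
  | cons i w =>
    rw [star_cons]
    change leftAct b 1 v (i :: w) + star b 0 v w = _
    rw [zero_star, map_one]
    simp

end Action

variable [DecidableEq ι] (i₀ : ι)

variable (F K) in
/-- Multiplication of series by `1 + z` from the left, where `b i₀ = 1`. -/
def onePlus : Module.End F (List ι → K) where
  toFun v
    | [] => v []
    | i :: w => v (i :: w) + if i = i₀ then v w else 0
  map_add' v v' := by
    ext w
    cases w with
    | nil => rfl
    | cons i w => simp only [Pi.add_apply]; split_ifs <;> ring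
  map_smul' c v := by
    ext w
    cases w with
    | nil => rfl
    | cons i w => simp only [Pi.smul_apply]; split_ifs <;> simp

/-- Division by `1 + z` from the left. -/
def divOnePlus (v : List ι → K) : List ι → K
  | [] => v []
  | i :: w => v (i :: w) - if i = i₀ then divOnePlus v w else 0

@[simp] theorem onePlus_nil (v : List ι → K) : onePlus F K i₀ v [] = v [] := rfl

theorem onePlus_cons (v : List ι → K) (i : ι) (w : List ι) :
    onePlus F K i₀ v (i :: w) = v (i :: w) + if i = i₀ then v w else 0 := rfl

@[simp] theorem divOnePlus_nil (v : List ι → K) : divOnePlus i₀ v [] = v [] := by rw [divOnePlus]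

theorem divOnePlus_cons (v : List ι → K) (i : ι) (w : List ι) :
    divOnePlus i₀ v (i :: w) = v (i :: w) - if i = i₀ then divOnePlus i₀ v w else 0 := by
  rw [divOnePlus]

variable (F) in
/-- Multiplication by `1 + z` as an invertible operator. -/
def onePlusEquiv : (List ι → K) ≃ₗ[F] (List ι → K) :=
  LinearEquiv.mk (onePlus F K i₀) (divOnePlus i₀)
    (fun v => by
      ext w
      induction w with
      | nil => simp
      | cons i w ih =>
        simp only [AddHom.toFun_eq_coe, LinearMap.coe_toAddHom] at ih ⊢
        rw [divOnePlus_cons, ih, onePlus_cons]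
        ring)
    (fun v => by
      ext w
      cases w with
      | nil => simp
      | cons i w =>
        simp only [AddHom.toFun_eq_coe, LinearMap.coe_toAddHom]
        rw [onePlus_cons, divOnePlus_cons]
        ring)

variable (F K) in
/-- The unit `1 + z`. -/
def onePlusUnit : (Module.End F (List ι → K))ˣ :=
  (LinearMap.GeneralLinearGroup.generalLinearEquiv F (List ι → K)).symm (onePlusEquiv F i₀)

@[simp] theorem coe_onePlusUnit : (onePlusUnit F K i₀ : Module.End F (List ι → K)) =
    onePlus F K i₀ := rfl

theorem star_onePlus [Fintype ι] (b : Module.Basis ι F K) (s v : List ι → K) :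
    star b (onePlus F K i₀ s) v = onePlus F K i₀ (star b s v) := by
  ext w
  cases w with
  | nil => simp [star_nil]
  | cons i w =>
    have h : (fun w' => onePlus F K i₀ s (i :: w')) =
        (fun w' => s (i :: w')) + if i = i₀ then s else 0 := by
      ext w'
      rw [onePlus_cons]
      split_ifs <;> rfl
    rw [star_cons, onePlus_cons, star_cons, h, ← starRight_apply, map_add, onePlus_nil,
      Pi.add_apply, ← add_assoc]
    split_ifs <;> simp [starRight_apply]

end Series

/-! ### Independence of the integral powers of `1 + X` -/

section PowerSeries

variable {K : Type*} [Field K]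

variable (K) in
/-- The power series `1 + X` as a unit. -/
def onePlusX : (PowerSeries K)ˣ :=
  ((PowerSeries.isUnit_iff_constantCoeff (φ := (1 + PowerSeries.X : PowerSeries K))).2
    (by simp)).unit

@[simp] theorem coe_onePlusX : (onePlusX K : PowerSeries K) = 1 + PowerSeries.X := rfl

/-- The powers of `1 + X` with integral exponents are linearly independent. -/
theorem linearIndependent_onePlusX_zpow :
    LinearIndependent K fun n : ℤ => ((onePlusX K ^ n : (PowerSeries K)ˣ) : PowerSeries K) := by
  classical
  rw [linearIndependent_iff']
  intro s g hg i hi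
  obtain ⟨N, hN⟩ : ∃ N : ℕ, ∀ n ∈ s, 0 ≤ n + N := by
    refine ⟨∑ n ∈ s, n.natAbs, fun n hn => ?_⟩
    have := Finset.single_le_sum (f := Int.natAbs) (fun _ _ => Nat.zero_le _) hn
    omega
  -- Multiplication by `(1 + X) ^ N` clears the negative exponents and leaves a polynomial identity.
  have hP : (∑ n ∈ s, Polynomial.C (g n) * (1 + Polynomial.X) ^ (n + N).toNat : K[X]) = 0 := by
    rw [← Polynomial.coe_eq_zero_iff]
    have h2 := congrArg (fun p => p * ((onePlusX K ^ (N : ℤ) : (PowerSeries K)ˣ) :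
      PowerSeries K)) hg
    simp only [zero_mul, Finset.sum_mul, smul_mul_assoc, ← Units.val_mul, ← zpow_add] at h2
    rw [← h2, ← Polynomial.coeToPowerSeries.ringHom_apply, map_sum]
    refine Finset.sum_congr rfl fun n hn => ?_
    have h3 : (onePlusX K ^ (n + N : ℤ)) = onePlusX K ^ (n + N).toNat := by
      conv_lhs => rw [← Int.toNat_of_nonneg (hN n hn), zpow_natCast]
    rw [h3]
    simp [PowerSeries.smul_eq_C_mul]
  -- Substituting `X - 1` for `X` turns powers of `1 + X` into monomials.
  have h4 := congrArg (fun p : K[X] => (aeval (Polynomial.X - 1 : K[X]) p).coeff (i + N).toNat) hP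
  simp only [map_sum, map_mul, map_pow, map_add, map_one, aeval_C, aeval_X, add_sub_cancel,
    Polynomial.algebraMap_eq, Polynomial.finsetSum_coeff, Polynomial.coeff_C_mul_X_pow, map_zero,
    Polynomial.coeff_zero] at h4
  rw [Finset.sum_eq_single i] at h4
  · simpa using h4
  · intro n hn hne
    rw [if_neg]
    have := hN n hn
    have := hN i hi
    omega
  · exact fun h => absurd hi h

/-- A constant is a multiple of the zeroth power of `1 + X`, so independence of all powers gives
independence of the nonzero ones modulo constants. -/
theorem eq_zero_of_coeff_sum_onePlusX_zpow {s : Finset ℤ} (hs : 0 ∉ s) {g : ℤ → K}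
    (h : ∀ m, PowerSeries.coeff (m + 1) (∑ n ∈ s, g n • ((onePlusX K ^ n : (PowerSeries K)ˣ) :
      PowerSeries K)) = 0) : ∀ n ∈ s, g n = 0 := by
  classical
  set p := ∑ n ∈ s, g n • ((onePlusX K ^ n : (PowerSeries K)ˣ) : PowerSeries K) with hp
  have h1 : p = PowerSeries.C (PowerSeries.coeff 0 p) := by
    ext m
    cases m with
    | zero => simp
    | succ m => rw [h m, PowerSeries.coeff_C, if_neg (Nat.succ_ne_zero m)]
  intro n hn
  have h2 := linearIndependent_iff'.1 (linearIndependent_onePlusX_zpow (K := K)) (insert 0 s)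
    (fun n => if n = 0 then -PowerSeries.coeff 0 p else g n) (by
      rw [Finset.sum_insert hs]
      have : ∑ n ∈ s, (if n = 0 then -PowerSeries.coeff 0 p else g n) •
          ((onePlusX K ^ n : (PowerSeries K)ˣ) : PowerSeries K) = p :=
        Finset.sum_congr rfl fun n hn => by
          rw [if_neg (ne_of_mem_of_not_mem hn hs)]
      rw [this]
      conv_lhs => rw [h1]
      simp [PowerSeries.smul_eq_C_mul]) n (Finset.mem_insert_of_mem hn)
  rwa [if_neg (ne_of_mem_of_not_mem hn hs)] at h2

end PowerSeries

/-! ### Counting syllables of words -/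

section Syllables

variable {F K ι : Type*} [Field F] [Field K] [Algebra F K] [DecidableEq ι] (i₀ : ι)

/-- The number of letters of a word that are different from `i₀`. -/
def numNe (w : List ι) : ℕ := w.countP (· ≠ i₀)

/-- The number of syllables `b i z ^ m` of a word, where `b i₀ = 1`. -/
def numSyl : List ι → ℕ
  | [] => 0
  | _ :: w => numNe i₀ w + 1

@[simp] theorem numSyl_nil : numSyl i₀ [] = 0 := rfl

@[simp] theorem numSyl_cons (i : ι) (w : List ι) : numSyl i₀ (i :: w) = numNe i₀ w + 1 := rfl

theorem numNe_cons_self (w : List ι) : numNe i₀ (i₀ :: w) = numNe i₀ w := by simp [numNe]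

theorem numNe_le_cons (i : ι) (w : List ι) : numNe i₀ w ≤ numNe i₀ (i :: w) :=
  (List.sublist_cons_self i w).countP_le

theorem numNe_replicate_append (m : ℕ) (w : List ι) :
    numNe i₀ (List.replicate m i₀ ++ w) = numNe i₀ w := by
  induction m with
  | zero => rfl
  | succ m ih => rw [List.replicate_succ, List.cons_append, numNe_cons_self, ih]

theorem numNe_eq_numSyl {w : List ι} (hw : ∀ i ∈ w.head?, i ≠ i₀) : numNe i₀ w = numSyl i₀ w := by
  cases w with
  | nil => rfl
  | cons i w => simp [numNe, numSyl, hw i (by simp)]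

variable (F K) in
/-- The series without terms of `r` or more syllables. -/
def sylLT (r : ℕ) : Submodule F (List ι → K) where
  carrier := {v | ∀ w, r ≤ numSyl i₀ w → v w = 0}
  add_mem' hv hv' w hw := by simp [hv w hw, hv' w hw]
  zero_mem' _ _ := rfl
  smul_mem' c v hv w hw := by simp [hv w hw]

theorem zpow_onePlusUnit_induction {P : (List ι → K) → Prop}
    (h : ∀ v, P v → P (onePlus F K i₀ v)) (h' : ∀ v, P v → P (divOnePlus i₀ v))
    {v : List ι → K} (hv : P v) (n : ℤ) :
    P ((↑(onePlusUnit F K i₀ ^ n) : Module.End F (List ι → K)) v) := by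
  induction n with
  | zero => simpa using hv
  | succ n ih =>
    rw [add_comm, zpow_add, zpow_one, Units.val_mul]
    exact h _ ih
  | pred n ih =>
    rw [sub_eq_neg_add, zpow_add, zpow_neg_one, Units.val_mul]
    exact h' _ ih

/-- Left multiplication by `z = b i₀ z` only produces words beginning with `i₀`. -/
theorem zpow_onePlusUnit_cons_of_ne {v : List ι → K} {i : ι} (hi : i ≠ i₀) (w : List ι) (n : ℤ) :
    (↑(onePlusUnit F K i₀ ^ n) : Module.End F (List ι → K)) v (i :: w) = v (i :: w) :=
  zpow_onePlusUnit_induction (F := F) i₀ (P := fun v' => v' (i :: w) = v (i :: w))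
    (fun v' h => by rw [onePlus_cons, if_neg hi, add_zero, h])
    (fun v' h => by rw [divOnePlus_cons, if_neg hi, sub_zero, h]) rfl n

/-- Prepending `i₀` leaves `numNe` unchanged, so a bound on `numNe` survives all powers of `1 + z`.
Since `numNe ≤ numSyl ≤ numNe + 1`, at most one syllable is gained. -/
theorem zpow_onePlusUnit_mem_sylLT {r : ℕ} {v : List ι → K} (hv : v ∈ sylLT F K i₀ r) (n : ℤ) :
    (↑(onePlusUnit F K i₀ ^ n) : Module.End F (List ι → K)) v ∈ sylLT F K i₀ (r + 1) := by
  have key := zpow_onePlusUnit_induction (F := F) i₀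
    (P := fun v : List ι → K => ∀ w, r ≤ numNe i₀ w → v w = 0) (v := v)
    (fun v h w hw => by
      cases w with
      | nil => exact h _ hw
      | cons i w =>
        rw [onePlus_cons, h _ hw, zero_add]
        split_ifs with hi
        · subst hi
          exact h _ (by rwa [numNe_cons_self] at hw)
        · rfl)
    (fun v h w hw => by
      induction w with
      | nil => exact h _ hw
      | cons i w ih =>
        rw [divOnePlus_cons, h _ hw, zero_sub, neg_eq_zero]
        split_ifs with hi
        · subst hi
          exact ih (by rwa [numNe_cons_self] at hw)
        · rfl)
    (fun w hw => by
      refine hv w (hw.trans ?_)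
      cases w with
      | nil => rfl
      | cons i w =>
        rw [numSyl_cons]
        simp only [numNe, List.countP_cons]
        split_ifs <;> omega) n
  intro w hw
  refine key w ?_
  cases w with
  | nil => simp at hw
  | cons i w =>
    have := numNe_le_cons i₀ i w
    simp at hw
    omega

/-- The coefficients of a series at `z ^ m w`, as a power series. -/
def zCoeff (w : List ι) (v : List ι → K) : PowerSeries K :=
  PowerSeries.mk fun m => v (List.replicate m i₀ ++ w)

/-- As `w` does not begin with `i₀`, the words `z ^ m w` form one string along which `z` acts as the
shift, with nothing entering at `m = 0`. -/
theorem zCoeff_onePlus {w : List ι} (hw : ∀ i ∈ w.head?, i ≠ i₀) (v : List ι → K) :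
    zCoeff i₀ w (onePlus F K i₀ v) = onePlusX K * zCoeff i₀ w v := by
  ext m
  rw [coe_onePlusX, add_mul, one_mul, map_add]
  cases m with
  | zero =>
    simp only [zCoeff, PowerSeries.coeff_mk, List.replicate_zero, List.nil_append,
      PowerSeries.coeff_zero_X_mul, add_zero]
    cases w with
    | nil => rfl
    | cons i w => rw [onePlus_cons, if_neg (hw i (by simp)), add_zero]
  | succ m =>
    rw [PowerSeries.coeff_succ_X_mul]
    simp [zCoeff, List.replicate_succ, onePlus_cons]

theorem zCoeff_zpow_onePlusUnit {w : List ι} (hw : ∀ i ∈ w.head?, i ≠ i₀) (v : List ι → K)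
    (n : ℤ) :
    zCoeff i₀ w ((↑(onePlusUnit F K i₀ ^ n) : Module.End F (List ι → K)) v) =
      ↑(onePlusX K ^ n) * zCoeff i₀ w v := by
  induction n with
  | zero => simp
  | succ n ih =>
    rw [add_comm, zpow_add, zpow_one, Units.val_mul, Module.End.mul_apply, coe_onePlusUnit,
      zCoeff_onePlus i₀ hw, ih, zpow_add, zpow_one, Units.val_mul, mul_assoc]
  | pred n ih =>
    rw [sub_eq_neg_add, zpow_add, zpow_add, Units.val_mul (onePlusX K ^ (-1 : ℤ)), mul_assoc, ← ih,
      zpow_neg_one (onePlusX K), Units.eq_inv_mul_iff_mul_eq, ← zCoeff_onePlus (F := F) i₀ hw,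
      zpow_neg_one, Units.val_mul, Module.End.mul_apply, ← coe_onePlusUnit,
      ← Module.End.mul_apply, Units.mul_inv, Module.End.one_apply]

/-- A nonempty block of letters `i₀` in front of `w` adds exactly one syllable, so only `m = 0` can
contribute. -/
theorem zCoeff_of_mem_sylLT {r : ℕ} {v : List ι → K} (hv : v ∈ sylLT F K i₀ (r + 1)) {w : List ι}
    (hw : ∀ i ∈ w.head?, i ≠ i₀) (hr : numSyl i₀ w = r) :
    zCoeff i₀ w v = PowerSeries.C (v w) := by
  ext m
  cases m with
  | zero => simp [zCoeff]
  | succ m =>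
    rw [zCoeff, PowerSeries.coeff_mk, PowerSeries.coeff_C, if_neg (Nat.succ_ne_zero m)]
    refine hv _ ?_
    rw [List.replicate_succ, List.cons_append, numSyl_cons, numNe_replicate_append,
      numNe_eq_numSyl i₀ hw, hr]

variable [Fintype ι] (b : Module.Basis ι F K)

theorem leftAct_mem_sylLT (k : K) {r : ℕ} {v : List ι → K} (hv : v ∈ sylLT F K i₀ r) :
    leftAct b k v ∈ sylLT F K i₀ r := by
  intro w hw
  cases w with
  | nil => rw [leftAct_nil, hv _ hw, mul_zero]
  | cons j w =>
    rw [leftAct_cons]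
    exact Finset.sum_eq_zero fun i _ => by rw [hv (i :: w) hw, smul_zero]

/-- The word is `b i z ^ (m + 1) w`, with `r + 1` syllables. Only its variant with first letter `i₀`
contributes, through the powers of `z` in `(1 + z) ^ n`; column `i₀` of the matrix of `b j` consists
of the coordinates of `b j * 1`. -/
theorem leftAct_zpow_onePlusUnit_apply (hb : b i₀ = 1) {r : ℕ} {v : List ι → K}
    (hv : v ∈ sylLT F K i₀ (r + 1)) {w : List ι} (hw : ∀ i ∈ w.head?, i ≠ i₀)
    (hr : numSyl i₀ w = r) (i j : ι) (n : ℤ) (m : ℕ) :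
    leftAct b (b j) ((↑(onePlusUnit F K i₀ ^ n) : Module.End F (List ι → K)) v)
      (i :: (List.replicate m i₀ ++ w)) =
    if j = i then PowerSeries.coeff (m + 1)
      (v w • ((onePlusX K ^ n : (PowerSeries K)ˣ) : PowerSeries K)) else 0 := by
  rw [leftAct_cons, Finset.sum_eq_single i₀]
  · have h := congrArg (PowerSeries.coeff (m + 1)) (zCoeff_zpow_onePlusUnit (F := F) i₀ hw v n)
    rw [zCoeff_of_mem_sylLT i₀ hv hw hr, mul_comm, ← PowerSeries.smul_eq_C_mul, zCoeff,
      PowerSeries.coeff_mk, List.replicate_succ, List.cons_append] at h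
    rw [h, Algebra.leftMulMatrix_eq_repr_mul, hb, mul_one, Module.Basis.repr_self,
      Finsupp.single_apply]
    split_ifs <;> simp
  · intro l _ hl
    rw [zpow_onePlusUnit_cons_of_ne i₀ hl, hv, smul_zero]
    rw [numSyl_cons, numNe_replicate_append, numNe_eq_numSyl i₀ hw, hr]
  · simp

end Syllables

/-! ### From the action to series -/

section ToSeries

variable {F K ι A : Type*} [Field F] [Field K] [Algebra F K] [Ring A] [Algebra F A]

theorem map_zpow_eq [DecidableEq ι] {i₀ : ι} {u : Aˣ}
    {ρ : A →ₐ[F] Module.End F (List ι → K)} (hu : ρ u = onePlus F K i₀) (n : ℤ) :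
    ρ ↑(u ^ n) = ↑(onePlusUnit F K i₀ ^ n) := by
  have h : Units.map (ρ : A →* Module.End F (List ι → K)) u = onePlusUnit F K i₀ := Units.ext hu
  rw [← h, ← map_zpow]
  rfl

variable (ρ : A →ₐ[F] Module.End F (List ι → K))

/-- The series of an element of an algebra that acts on series. -/
def toSeries : A →ₗ[F] (List ι → K) := LinearMap.applyₗ oneSeries ∘ₗ ρ.toLinearMap

theorem toSeries_apply (a : A) : toSeries ρ a = ρ a oneSeries := rfl

theorem toSeries_mul (a a' : A) : toSeries ρ (a * a') = ρ a (toSeries ρ a') := by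
  simp [toSeries_apply]

end ToSeries

/-! ### Normal forms and the criterion for being a domain -/

section NormalForms

variable {F K ι A : Type*} [Field F] [Field K] [Algebra F K] [Fintype ι] [Ring A] [Algebra F A]
  (b : Module.Basis ι F K) (i₀ : ι) (κ : K →ₐ[F] A) (u : Aˣ)

/-- The sums `∑ κ (b i) u ^ n s n i`. -/
def assemble : (ℤ →₀ (ι → A)) →ₗ[F] A :=
  Finsupp.lsum ℕ fun n => ∑ i, LinearMap.mulLeft F (κ (b i) * ↑(u ^ n)) ∘ₗ LinearMap.proj i

theorem assemble_apply (s : ℤ →₀ (ι → A)) :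
    assemble b κ u s = ∑ n ∈ s.support, ∑ i, κ (b i) * ↑(u ^ n) * s n i := by
  simp [assemble, Finsupp.sum, LinearMap.sum_apply, mul_assoc]

/-- The families of elements of `N`, indexed by non-zero exponents and by elements of `J`. -/
def families (N : Submodule F A) (J : Set ι) : Submodule F (ℤ →₀ (ι → A)) where
  carrier := {s | s 0 = 0 ∧ ∀ n i, s n i ∈ N ∧ (i ∉ J → s n i = 0)}
  add_mem' {s t} hs ht := by
    refine ⟨by simp [hs.1, ht.1], fun n i => ⟨?_, fun hi => ?_⟩⟩
    · exact N.add_mem (hs.2 n i).1 (ht.2 n i).1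
    · simp [(hs.2 n i).2 hi, (ht.2 n i).2 hi]
  zero_mem' := ⟨rfl, fun _ _ => ⟨N.zero_mem, fun _ => rfl⟩⟩
  smul_mem' c s hs := by
    refine ⟨by simp [hs.1], fun n i => ⟨?_, fun hi => ?_⟩⟩
    · exact N.smul_mem c (hs.2 n i).1
    · simp [(hs.2 n i).2 hi]

/-- The elements with a normal form of less than `r` syllables `κ (b i) u ^ n`, `n ≠ 0`, whose first
letter `i` belongs to `J`, and whose other letters are different from `i₀`. -/
def normalForms : ℕ → Set ι → Submodule F A
  | 0, _ => ⊥
  | r + 1, J => LinearMap.range κ.toLinearMap ⊔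
      (families (normalForms r {i₀}ᶜ) J).map (assemble b κ u)

theorem normalForms_zero (J : Set ι) : normalForms b i₀ κ u 0 J = ⊥ := by rw [normalForms]

theorem normalForms_succ (r : ℕ) (J : Set ι) :
    normalForms b i₀ κ u (r + 1) J = LinearMap.range κ.toLinearMap ⊔
      (families (normalForms b i₀ κ u r {i₀}ᶜ) J).map (assemble b κ u) := by
  rw [normalForms]

variable {b i₀ κ u}

theorem mem_normalForms_succ {r : ℕ} {J : Set ι} {a : A} :
    a ∈ normalForms b i₀ κ u (r + 1) J ↔
      ∃ c, ∃ s ∈ families (normalForms b i₀ κ u r {i₀}ᶜ) J, κ c + assemble b κ u s = a := by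
  rw [normalForms_succ, Submodule.mem_sup]
  simp

theorem algHom_mem_normalForms (r : ℕ) (J : Set ι) (c : K) :
    κ c ∈ normalForms b i₀ κ u (r + 1) J :=
  mem_normalForms_succ.2 ⟨c, 0, Submodule.zero_mem _, by simp⟩

theorem normalForms_succ_le {r : ℕ} {J : Set ι} {P : Submodule F A} (hκ : ∀ c, κ c ∈ P)
    (h : ∀ i ∈ J, ∀ n : ℤ, n ≠ 0 → ∀ s ∈ normalForms b i₀ κ u r {i₀}ᶜ,
      κ (b i) * ↑(u ^ n) * s ∈ P) : normalForms b i₀ κ u (r + 1) J ≤ P := by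
  intro a ha
  obtain ⟨c, s, hs, rfl⟩ := mem_normalForms_succ.1 ha
  refine P.add_mem (hκ c) ?_
  rw [assemble_apply]
  refine P.sum_mem fun n hn => P.sum_mem fun i _ => ?_
  by_cases hi : i ∈ J
  · refine h i hi n ?_ _ (hs.2 n i).1
    rintro rfl
    exact Finsupp.mem_support_iff.1 hn hs.1
  · rw [(hs.2 n i).2 hi, mul_zero]
    exact P.zero_mem

variable [DecidableEq ι]

theorem mul_mem_normalForms {r : ℕ} {J : Set ι} {i : ι} (hi : i ∈ J) {n : ℤ} (hn : n ≠ 0) {s : A}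
    (hs : s ∈ normalForms b i₀ κ u r {i₀}ᶜ) :
    κ (b i) * ↑(u ^ n) * s ∈ normalForms b i₀ κ u (r + 1) J := by
  refine mem_normalForms_succ.2 ⟨0, Finsupp.single n (Pi.single i s), ⟨?_, fun m j => ?_⟩, ?_⟩
  · rw [Finsupp.single_apply, if_neg hn]
  · rw [Finsupp.single_apply]
    split_ifs
    · by_cases hj : j = i
      · subst hj
        simpa using ⟨hs, fun h => absurd hi h⟩
      · simp [Pi.single_eq_of_ne hj]
    · simp
  · simp only [assemble, Finsupp.lsum_single, map_zero, zero_add, LinearMap.sum_apply,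
      LinearMap.comp_apply, LinearMap.proj_apply, LinearMap.mulLeft_apply]
    rw [Finset.sum_eq_single i]
    · simp
    · intro j _ hj
      simp [Pi.single_eq_of_ne hj]
    · simp

theorem normalForms_le_of_subset (r : ℕ) {J J' : Set ι} (h : J ⊆ J') :
    normalForms b i₀ κ u r J ≤ normalForms b i₀ κ u r J' := by
  cases r with
  | zero => rw [normalForms_zero, normalForms_zero]
  | succ r =>
    exact normalForms_succ_le (algHom_mem_normalForms r J') fun i hi n hn s hs =>
      mul_mem_normalForms (h hi) hn hs

theorem normalForms_le_succ (r : ℕ) (J : Set ι) :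
    normalForms b i₀ κ u r J ≤ normalForms b i₀ κ u (r + 1) J := by
  induction r generalizing J with
  | zero => rw [normalForms_zero]; exact bot_le
  | succ r ih =>
    exact normalForms_succ_le (algHom_mem_normalForms _ _) fun i hi n hn s hs =>
      mul_mem_normalForms hi hn (ih _ hs)

theorem normalForms_mono {r r' : ℕ} (h : r ≤ r') (J : Set ι) :
    normalForms b i₀ κ u r J ≤ normalForms b i₀ κ u r' J :=
  monotone_nat_of_le_succ (f := fun r => normalForms b i₀ κ u r J)
    (fun r => normalForms_le_succ r J) h

theorem algHom_mul_mem_normalForms (k : K) {r : ℕ} {a : A}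
    (ha : a ∈ normalForms b i₀ κ u r Set.univ) :
    κ k * a ∈ normalForms b i₀ κ u r Set.univ := by
  cases r with
  | zero =>
    rw [normalForms_zero, Submodule.mem_bot] at ha
    rw [ha, mul_zero]
    exact Submodule.zero_mem _
  | succ r =>
    refine normalForms_succ_le (P := (normalForms b i₀ κ u (r + 1) Set.univ).comap
      (LinearMap.mulLeft F (κ k))) (fun c => ?_) (fun i _ n hn s hs => ?_) ha
    · rw [Submodule.mem_comap, LinearMap.mulLeft_apply, ← map_mul]
      exact algHom_mem_normalForms _ _ _
    · rw [Submodule.mem_comap, LinearMap.mulLeft_apply, ← mul_assoc, ← mul_assoc, ← map_mul,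
        ← b.sum_repr (k * b i), map_sum, Finset.sum_mul, Finset.sum_mul]
      refine Submodule.sum_mem _ fun j _ => ?_
      rw [map_smul, smul_mul_assoc, smul_mul_assoc]
      exact Submodule.smul_mem _ _ (mul_mem_normalForms (Set.mem_univ j) hn hs)

theorem zpow_mul_mem_normalForms (hb : b i₀ = 1) (m : ℤ) {r : ℕ} {a : A}
    (ha : a ∈ normalForms b i₀ κ u r Set.univ) :
    ↑(u ^ m) * a ∈ normalForms b i₀ κ u (r + 1) Set.univ := by
  -- As `b i₀ = 1`, a bare power of `u` is a syllable with letter `i₀`.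
  have single : ∀ {n : ℤ} {r : ℕ} {s : A}, n ≠ 0 → s ∈ normalForms b i₀ κ u r {i₀}ᶜ →
      ↑(u ^ n) * s ∈ normalForms b i₀ κ u (r + 1) Set.univ := fun hn hs => by
    simpa [hb] using mul_mem_normalForms (Set.mem_univ i₀) hn hs
  by_cases hm : m = 0
  · subst hm
    simpa using normalForms_le_succ _ _ ha
  cases r with
  | zero =>
    rw [normalForms_zero, Submodule.mem_bot] at ha
    rw [ha, mul_zero]
    exact Submodule.zero_mem _
  | succ r =>
    refine normalForms_succ_le (P := (normalForms b i₀ κ u (r + 2) Set.univ).comap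
      (LinearMap.mulLeft F ((u ^ m : Aˣ) : A))) (fun c => ?_) (fun i _ n hn s hs => ?_) ha
    · exact single hm (algHom_mem_normalForms _ _ _)
    · rw [Submodule.mem_comap, LinearMap.mulLeft_apply]
      by_cases hi : i = i₀
      · subst hi
        rw [hb, map_one, one_mul, ← mul_assoc, ← Units.val_mul, ← zpow_add]
        -- With first letter `i₀` the two powers of `u` merge, and the syllable disappears if the
        -- exponents cancel.
        by_cases hmn : m + n = 0
        · rw [hmn, zpow_zero, Units.val_one, one_mul]
          exact normalForms_mono (by omega) _ (normalForms_le_of_subset _ (Set.subset_univ _) hs)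
        · exact normalForms_le_succ _ _ (single hmn hs)
      · exact single hm (mul_mem_normalForms hi hn hs)

/-- Every element has a normal form. -/
theorem exists_mem_normalForms (hb : b i₀ = 1)
    (hgen : Algebra.adjoin F (Set.range κ ∪ {↑u, ↑u⁻¹}) = ⊤) (a : A) :
    ∃ r, a ∈ normalForms b i₀ κ u r Set.univ := by
  have ha : a ∈ Algebra.adjoin F (Set.range κ ∪ {(u : A), ↑u⁻¹}) := hgen ▸ Algebra.mem_top
  suffices h : ∀ (a : A), a ∈ Algebra.adjoin F (Set.range κ ∪ {(u : A), ↑u⁻¹}) →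
      ∀ r, ∀ s ∈ normalForms b i₀ κ u r Set.univ,
        ∃ r', a * s ∈ normalForms b i₀ κ u r' Set.univ by
    simpa using h a ha 1 1 (map_one κ ▸ algHom_mem_normalForms 0 Set.univ (1 : K))
  intro a ha
  induction ha using Algebra.adjoin_induction with
  | mem a ha =>
    intro r s hs
    rcases ha with ⟨k, rfl⟩ | rfl | rfl
    · exact ⟨r, algHom_mul_mem_normalForms k hs⟩
    · exact ⟨r + 1, by simpa using zpow_mul_mem_normalForms hb 1 hs⟩
    · exact ⟨r + 1, by simpa using zpow_mul_mem_normalForms hb (-1) hs⟩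
  | algebraMap c =>
    intro r s hs
    exact ⟨r, by rw [← Algebra.smul_def]; exact Submodule.smul_mem _ c hs⟩
  | add a a' _ _ h h' =>
    intro r s hs
    obtain ⟨r₁, h₁⟩ := h r s hs
    obtain ⟨r₂, h₂⟩ := h' r s hs
    refine ⟨max r₁ r₂, ?_⟩
    rw [add_mul]
    exact Submodule.add_mem _ (normalForms_mono (le_max_left _ _) _ h₁)
      (normalForms_mono (le_max_right _ _) _ h₂)
  | mul a a' _ _ h h' =>
    intro r s hs
    obtain ⟨r₁, h₁⟩ := h' r s hs
    rw [mul_assoc]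
    exact h r₁ _ h₁

variable {ρ : A →ₐ[F] Module.End F (List ι → K)} (hκ : ∀ k, ρ (κ k) = leftAct b k)
  (hu : ρ u = onePlus F K i₀)

include hκ in
theorem toSeries_algHom_nil (c : K) : toSeries ρ (κ c) [] = c := by
  rw [toSeries_apply, hκ, leftAct_nil, oneSeries, mul_one]

include hκ in
theorem toSeries_algHom_cons (c : K) (j : ι) (w : List ι) : toSeries ρ (κ c) (j :: w) = 0 := by
  rw [toSeries_apply, hκ, leftAct_cons]
  simp [oneSeries]

include hκ hu

theorem toSeries_mem_sylLT {r : ℕ} {J : Set ι} {a : A} (ha : a ∈ normalForms b i₀ κ u r J) :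
    toSeries ρ a ∈ sylLT F K i₀ r := by
  induction r generalizing J a with
  | zero =>
    rw [normalForms_zero, Submodule.mem_bot] at ha
    rw [ha, map_zero]
    exact Submodule.zero_mem _
  | succ r ih =>
    refine normalForms_succ_le (P := (sylLT F K i₀ (r + 1)).comap (toSeries ρ)) (fun c w hw => ?_)
      (fun i _ n hn s hs => ?_) ha
    · cases w with
      | nil => simp at hw
      | cons j w => exact toSeries_algHom_cons hκ c j w
    · rw [Submodule.mem_comap, mul_assoc, toSeries_mul, toSeries_mul, hκ, map_zpow_eq hu]
      exact leftAct_mem_sylLT i₀ b _ (zpow_onePlusUnit_mem_sylLT i₀ (ih hs) n)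

/-- Here `a` has at most `r` syllables, and the induction strips the first one. For a fixed tail
word `w`, the coefficients at `b i z ^ (m + 1) w` are those of a combination of nonzero powers of `1
+ z`, so every tail has coefficient zero at `w`. -/
theorem mem_normalForms_of_toSeries (hb : b i₀ = 1) {r : ℕ} {J : Set ι} {a : A}
    (ha : a ∈ normalForms b i₀ κ u (r + 1) J)
    (h : ∀ w, numSyl i₀ w = r → (∀ i ∈ w.head?, i ∈ J) → toSeries ρ a w = 0) :
    a ∈ normalForms b i₀ κ u r J := by
  induction r generalizing J a with
  | zero =>
    obtain ⟨c, s, hs, rfl⟩ := mem_normalForms_succ.1 ha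
    have hs0 : s = 0 := by
      ext n i
      have := (hs.2 n i).1
      rwa [normalForms_zero, Submodule.mem_bot] at this
    subst hs0
    have := h [] rfl (by simp)
    rw [map_zero, add_zero, toSeries_algHom_nil hκ] at this
    rw [this, map_zero, map_zero, add_zero]
    exact Submodule.zero_mem _
  | succ r ih =>
    obtain ⟨c, s, hs, rfl⟩ := mem_normalForms_succ.1 ha
    refine mem_normalForms_succ.2 ⟨c, s, ⟨hs.1, fun n i => ⟨?_, (hs.2 n i).2⟩⟩, rfl⟩
    by_cases hi : i ∈ J
    swap
    · rw [(hs.2 n i).2 hi]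
      exact Submodule.zero_mem _
    by_cases hn : n ∈ s.support
    swap
    · rw [Finsupp.notMem_support_iff.1 hn]
      exact Submodule.zero_mem _
    refine ih (hs.2 n i).1 fun w hw hhead => ?_
    refine eq_zero_of_coeff_sum_onePlusX_zpow (s := s.support)
      (g := fun n => toSeries ρ (s n i) w) (by simpa using hs.1) (fun m => ?_) n hn
    have hm := h (i :: (List.replicate m i₀ ++ w))
      (by rw [numSyl_cons, numNe_replicate_append, numNe_eq_numSyl i₀ hhead, hw])
      (by simpa using hi)
    rw [map_add, Pi.add_apply, toSeries_algHom_cons hκ, zero_add, assemble_apply, map_sum,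
      Finset.sum_apply] at hm
    rw [map_sum, ← hm]
    refine Finset.sum_congr rfl fun n _ => ?_
    rw [map_sum, Finset.sum_apply, Finset.sum_eq_single i]
    · rw [mul_assoc, toSeries_mul, toSeries_mul, hκ, map_zpow_eq hu,
        leftAct_zpow_onePlusUnit_apply i₀ b hb (toSeries_mem_sylLT hκ hu (hs.2 n i).1) hhead hw,
        if_pos rfl]
    · intro j _ hj
      rw [mul_assoc, toSeries_mul, toSeries_mul, hκ, map_zpow_eq hu,
        leftAct_zpow_onePlusUnit_apply i₀ b hb (toSeries_mem_sylLT hκ hu (hs.2 n j).1) hhead hw,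
        if_neg hj]
    · simp

theorem eq_zero_of_toSeries_eq_zero (hb : b i₀ = 1) {r : ℕ} {J : Set ι} {a : A}
    (ha : a ∈ normalForms b i₀ κ u r J) (h : toSeries ρ a = 0) : a = 0 := by
  induction r with
  | zero => rwa [normalForms_zero, Submodule.mem_bot] at ha
  | succ r ih =>
    exact ih (mem_normalForms_of_toSeries hκ hu hb ha fun w _ _ => by rw [h, Pi.zero_apply])

/-- The action on series commutes with multiplication from the right. -/
theorem map_star (hgen : Algebra.adjoin F (Set.range κ ∪ {↑u, ↑u⁻¹}) = ⊤) (a : A)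
    (s v : List ι → K) : ρ a (star b s v) = star b (ρ a s) v := by
  have hcomm : Commute (starRight b v) (ρ u) := by
    rw [hu]
    exact LinearMap.ext fun s => star_onePlus i₀ b s v
  -- The elements whose action commutes with right multiplication by `v` form a subalgebra, so
  -- generators suffice.
  have hle : Algebra.adjoin F (Set.range κ ∪ {(u : A), ↑u⁻¹}) ≤
      (Subalgebra.centralizer F {starRight b v}).comap ρ := by
    refine Algebra.adjoin_le ?_
    rintro a (⟨k, rfl⟩ | rfl | rfl) <;>
      simp only [Subalgebra.coe_comap, Set.mem_preimage, SetLike.mem_coe,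
        Subalgebra.mem_centralizer_iff, Set.mem_singleton_iff, forall_eq]
    · rw [hκ]
      exact LinearMap.ext fun s => star_leftAct b k s v
    · exact hcomm
    · exact Commute.units_inv_right
        (u := Units.map (ρ : A →* Module.End F (List ι → K)) u) hcomm
  have ha : a ∈ (Subalgebra.centralizer F {starRight b v}).comap ρ :=
    hle (hgen ▸ Algebra.mem_top)
  simp only [Subalgebra.mem_comap, Subalgebra.mem_centralizer_iff, Set.mem_singleton_iff,
    forall_eq] at ha
  exact (LinearMap.congr_fun ha s).symm

/-- An algebra generated by a field and a unit that acts on the series in such a way that the unit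
acts as `1 + z` is a domain. -/
theorem isDomain_of_action (hb : b i₀ = 1)
    (hgen : Algebra.adjoin F (Set.range κ ∪ {↑u, ↑u⁻¹}) = ⊤) : IsDomain A := by
  have hinj : ∀ a, toSeries ρ a = 0 → a = 0 := fun a ha => by
    obtain ⟨r, hr⟩ := exists_mem_normalForms hb hgen a
    exact eq_zero_of_toSeries_eq_zero hκ hu hb hr ha
  have hmul : ∀ a a', toSeries ρ (a * a') = star b (toSeries ρ a) (toSeries ρ a') := fun a a' => by
    rw [toSeries_mul, toSeries_apply ρ a, ← map_star hκ hu hgen, oneSeries_star]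
  have : Nontrivial A := by
    refine ⟨1, 0, fun h => ?_⟩
    have := congrFun (congrArg (toSeries ρ) h) []
    simp [toSeries_apply, oneSeries] at this
  have : NoZeroDivisors A := ⟨fun {a a'} h => by
    by_contra! hne
    exact star_ne_zero b (fun h0 => hne.1 (hinj _ h0)) (fun h0 => hne.2 (hinj _ h0))
      (by rw [← hmul, h, map_zero])⟩
  exact NoZeroDivisors.to_isDomain A

end NormalForms

/-! ### Free products of two algebras -/

section FreeProd

variable {A B : Type} [Ring A] [Ring B] [Algebra ℚ A] [Algebra ℚ B]
variable {D : Type*} [Ring D] [Algebra ℚ D]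

/-- The homomorphism from the free product defined by homomorphisms from the two factors. -/
def prodLift (φ : A →ₐ[ℚ] D) (ψ : B →ₐ[ℚ] D) : FreeProd A B →ₐ[ℚ] D :=
  LinearAlgebra.FreeProduct.lift ℚ (Factor A B) fun {i} =>
    match i with
    | false => φ
    | true => ψ

@[simp] theorem prodLift_inl (φ : A →ₐ[ℚ] D) (ψ : B →ₐ[ℚ] D) (a : A) :
    prodLift φ ψ (inl A B a) = φ a :=
  DFunLike.congr_fun (LinearAlgebra.FreeProduct.lift_comp_ι (i := false) ℚ (Factor A B) _) a

@[simp] theorem prodLift_inr (φ : A →ₐ[ℚ] D) (ψ : B →ₐ[ℚ] D) (b : B) :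
    prodLift φ ψ (inr A B b) = ψ b :=
  DFunLike.congr_fun (LinearAlgebra.FreeProduct.lift_comp_ι (i := true) ℚ (Factor A B) _) b

theorem freeProd_hom_ext {φ ψ : FreeProd A B →ₐ[ℚ] D}
    (hl : φ.comp (inl A B) = ψ.comp (inl A B)) (hr : φ.comp (inr A B) = ψ.comp (inr A B)) :
    φ = ψ := by
  apply (LinearAlgebra.FreeProduct.lift ℚ (Factor A B)).symm.injective
  funext i
  cases i
  · exact hl
  · exact hr

/-- The free product of two non-trivial commutative algebras over `ℚ` exists. -/
theorem isStrictFreeProd (A B : Type) [CommRing A] [CommRing B] [Algebra ℚ A] [Algebra ℚ B]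
    [Nontrivial A] [Nontrivial B] : IsStrictFreeProd A B := by
  let Φ : FreeProd A B →ₐ[ℚ] TensorProduct ℚ A B :=
    prodLift Algebra.TensorProduct.includeLeft Algebra.TensorProduct.includeRight
  have hl : ∀ a, Φ (inl A B a) = Algebra.TensorProduct.includeLeft (S := ℚ) a := prodLift_inl _ _
  have hr : ∀ b, Φ (inr A B b) = Algebra.TensorProduct.includeRight b := prodLift_inr _ _
  have injl : Function.Injective
      (Algebra.TensorProduct.includeLeft : A →ₐ[ℚ] TensorProduct ℚ A B) :=
    Algebra.TensorProduct.includeLeft_injective (algebraMap ℚ B).injective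
  have injr : Function.Injective
      (Algebra.TensorProduct.includeRight : B →ₐ[ℚ] TensorProduct ℚ A B) :=
    Algebra.TensorProduct.includeRight_injective (algebraMap ℚ A).injective
  refine ⟨fun a a' h => injl ?_, fun b b' h => injr ?_, eq_bot_iff.2 ?_⟩
  · rw [← hl, ← hl, h]
  · rw [← hr, ← hr, h]
  · rintro _ ⟨⟨a, rfl⟩, ⟨b, hb⟩⟩
    -- A common element of the two images maps into `(A ⊗ 1) ∩ (1 ⊗ B) = ℚ`.
    have hmem : Algebra.TensorProduct.includeLeft (R := ℚ) (S := ℚ) (B := B) a ∈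
        (⊥ : Subalgebra ℚ (TensorProduct ℚ A B)) := by
      rw [← (Subalgebra.LinearDisjoint.include_range ℚ A B).inf_eq_bot]
      refine ⟨⟨a, rfl⟩, ⟨b, ?_⟩⟩
      change Algebra.TensorProduct.includeRight b = _
      rw [← hl a, ← hr b]
      exact congrArg Φ hb
    obtain ⟨c, hc⟩ := Algebra.mem_bot.1 hmem
    refine Algebra.mem_bot.2 ⟨c, ?_⟩
    have : algebraMap ℚ A c = a := injl (by rw [AlgHom.commutes, hc])
    change _ = inl A B a
    rw [← this, AlgHom.commutes]

end FreeProd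

/-! ### Universal property of Laurent polynomials -/

section Laurent

variable {D : Type*} [Ring D] [Algebra ℚ D]

/-- The homomorphism from the ring of Laurent polynomials that maps `T` to a given unit. -/
def laurentLift (u : Dˣ) : LaurentPolynomial ℚ →ₐ[ℚ] D :=
  AddMonoidAlgebra.lift ℚ D ℤ ((Units.coeHom D).comp (zpowersHom Dˣ u))

@[simp] theorem laurentLift_T (u : Dˣ) (n : ℤ) :
    laurentLift u (LaurentPolynomial.T n) = ↑(u ^ n) := by
  rw [laurentLift, LaurentPolynomial.T, AddMonoidAlgebra.lift_single, one_smul]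
  simp

/-- The variable of the ring of Laurent polynomials as a unit. -/
def laurentX : (LaurentPolynomial ℚ)ˣ where
  val := LaurentPolynomial.T 1
  inv := LaurentPolynomial.T (-1)
  val_inv := by rw [← LaurentPolynomial.T_add]; simp
  inv_val := by rw [← LaurentPolynomial.T_add]; simp

theorem coe_laurentX_zpow (n : ℤ) :
    ((laurentX ^ n : (LaurentPolynomial ℚ)ˣ) : LaurentPolynomial ℚ) = LaurentPolynomial.T n := by
  induction n with
  | zero => simp
  | succ n ih =>
    rw [zpow_add, Units.val_mul, ih, zpow_one, LaurentPolynomial.T_add]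
    rfl
  | pred n ih =>
    rw [zpow_sub, zpow_one, Units.val_mul, ih, sub_eq_add_neg, LaurentPolynomial.T_add]
    rfl

theorem laurent_hom_ext {φ ψ : LaurentPolynomial ℚ →ₐ[ℚ] D}
    (h : φ (LaurentPolynomial.T 1) = ψ (LaurentPolynomial.T 1)) : φ = ψ := by
  refine AddMonoidAlgebra.algHom_ext (fun n => ?_) (AlgHom.ext fun c => ?_)
  · have hu : Units.map (φ : LaurentPolynomial ℚ →* D) laurentX =
        Units.map (ψ : LaurentPolynomial ℚ →* D) laurentX := Units.ext h
    have := congrArg (fun v : Dˣ => ((v ^ n : Dˣ) : D)) hu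
    simp only [← map_zpow, Units.coe_map, coe_laurentX_zpow] at this
    exact this
  · exact ((φ.comp AddMonoidAlgebra.singleZeroAlgHom).commutes c).trans
      ((ψ.comp AddMonoidAlgebra.singleZeroAlgHom).commutes c).symm

end Laurent

/-! ### Roots of polynomials in noncommutative algebras -/

section Aeval

variable {D : Type*} [Ring D] [Algebra ℚ D]

/-- A root of a polynomial with non-zero constant term is a unit. -/
theorem isUnit_of_aeval_eq_zero {f : ℚ[X]} (hf : f.coeff 0 ≠ 0) {t : D} (ht : aeval t f = 0) :
    IsUnit t := by
  have h : aeval t f.divX * t = -algebraMap ℚ D (f.coeff 0) := by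
    rw [← divX_mul_X_add f] at ht
    rw [map_add, map_mul, aeval_X, aeval_C] at ht
    exact eq_neg_of_add_eq_zero_left (by simpa using ht)
  have hc : Commute (aeval t f.divX) t := by
    have := Commute.map (Commute.all f.divX X) (aeval t : ℚ[X] →ₐ[ℚ] D)
    rwa [aeval_X] at this
  have hu : IsUnit (aeval t f.divX * t) := by
    rw [h, IsUnit.neg_iff]
    exact (isUnit_iff_ne_zero.2 hf).map _
  exact (hc.isUnit_mul_iff.1 hu).2

theorem mul_aeval_mul (a b : D) (p : ℚ[X]) :
    b * aeval (a * b) p = aeval (b * a) p * b := by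
  induction p using Polynomial.induction_on' with
  | add p q hp hq => rw [map_add, map_add, mul_add, add_mul, hp, hq]
  | monomial n c =>
    have h : b * (a * b) ^ n = (b * a) ^ n * b := (SemiconjBy.pow_right (mul_assoc b a b).symm n)
    rw [aeval_monomial, aeval_monomial, mul_assoc, ← h, ← mul_assoc, ← mul_assoc,
      Algebra.commutes c b]

/-- The homomorphism from `ℚ[t] / ⟨f⟩` to a not necessarily commutative algebra defined by a root of
`f`. -/
def rootLift (f : ℚ[X]) (t : D) (ht : aeval t f = 0) : AdjoinRoot f →ₐ[ℚ] D :=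
  Ideal.Quotient.liftₐ (Ideal.span {f}) (aeval t) fun p hp => by
    obtain ⟨q, rfl⟩ := Ideal.mem_span_singleton'.1 hp
    rw [map_mul, ht, mul_zero]

@[simp] theorem rootLift_root (f : ℚ[X]) (t : D) (ht : aeval t f = 0) :
    rootLift f t ht (AdjoinRoot.root f) = t :=
  aeval_X t

end Aeval

/-! ### The isomorphism between `R_f` and the free product -/

section PolyRing

variable (f : ℚ[X])

/-- The generator `y` of `R_f`. -/
def genY : PolyRing f := RingCon.mkₐ ℚ _ y

/-- The generator `ȳ` of `R_f`. -/
def genYBar : PolyRing f := RingCon.mkₐ ℚ _ yBar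

theorem mk_eq_zero {I : TwoSidedIdeal NCPoly} {a : NCPoly} (ha : a ∈ I) :
    RingCon.mkₐ ℚ I.ringCon a = 0 :=
  (RingCon.eq _).2 ha

theorem aeval_genY_mul : aeval (genY f * genYBar f) f = 0 := by
  rw [genY, genYBar, ← map_mul, aeval_algHom_apply]
  exact mk_eq_zero (TwoSidedIdeal.subset_span (by simp))

theorem aeval_genYBar_mul : aeval (genYBar f * genY f) f = 0 := by
  rw [genY, genYBar, ← map_mul, aeval_algHom_apply]
  exact mk_eq_zero (TwoSidedIdeal.subset_span (by simp))

variable {D : Type*} [Ring D] [Algebra ℚ D]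

/-- The universal property of `R_f`. -/
def polyRingLift (a a' : D) (h : aeval (a * a') f = 0) (h' : aeval (a' * a) f = 0) :
    PolyRing f →ₐ[ℚ] D :=
  RingCon.liftₐ (polyIdeal f).ringCon (FreeAlgebra.lift ℚ ![a, a']) (by
    have hle : polyIdeal f ≤ TwoSidedIdeal.ker (FreeAlgebra.lift ℚ ![a, a']) := by
      refine TwoSidedIdeal.span_le.2 ?_
      rintro _ (rfl | rfl) <;>
        rw [SetLike.mem_coe, TwoSidedIdeal.mem_ker, ← aeval_algHom_apply, map_mul] <;>
        simpa [y, yBar]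
    exact TwoSidedIdeal.ringCon_le_iff.1 hle)

@[simp] theorem polyRingLift_genY (a a' : D) (h : aeval (a * a') f = 0)
    (h' : aeval (a' * a) f = 0) : polyRingLift f a a' h h' (genY f) = a :=
  FreeAlgebra.lift_ι_apply (R := ℚ) ![a, a'] 0

@[simp] theorem polyRingLift_genYBar (a a' : D) (h : aeval (a * a') f = 0)
    (h' : aeval (a' * a) f = 0) : polyRingLift f a a' h h' (genYBar f) = a' :=
  FreeAlgebra.lift_ι_apply (R := ℚ) ![a, a'] 1

variable {f}

theorem polyRing_hom_ext {φ ψ : PolyRing f →ₐ[ℚ] D} (h : φ (genY f) = ψ (genY f))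
    (h' : φ (genYBar f) = ψ (genYBar f)) : φ = ψ := by
  have : φ.comp (RingCon.mkₐ ℚ _) = ψ.comp (RingCon.mkₐ ℚ _) := by
    apply FreeAlgebra.hom_ext
    funext i
    fin_cases i
    · exact h
    · exact h'
  refine AlgHom.ext fun a => ?_
  obtain ⟨a, rfl⟩ := RingCon.mkₐ_surjective (α := ℚ) (polyIdeal f).ringCon a
  exact DFunLike.congr_fun this a

/-- Invertibility of `y ȳ` gives `y` a right inverse, that of `ȳ y` a left one; both relations are
needed. -/
theorem isUnit_genY (hf : f.coeff 0 ≠ 0) : IsUnit (genY f) := by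
  obtain ⟨v, hv⟩ := isUnit_of_aeval_eq_zero hf (aeval_genY_mul f)
  obtain ⟨w, hw⟩ := isUnit_of_aeval_eq_zero hf (aeval_genYBar_mul f)
  refine isUnit_iff_exists_and_exists.2 ⟨⟨genYBar f * ↑v⁻¹, ?_⟩, ⟨↑w⁻¹ * genYBar f, ?_⟩⟩
  · rw [← mul_assoc, ← hv, Units.mul_inv]
  · rw [mul_assoc, ← hw, Units.inv_mul]

variable (f) in
/-- The free product of `ℚ[x, x⁻¹]` and `ℚ[t] / ⟨f⟩`. -/
abbrev LaurentProd : Type := FreeProd (LaurentPolynomial ℚ) (AdjoinRoot f)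

variable (f) in
/-- The variable `x` as a unit of the free product. -/
def prodX : (LaurentProd f)ˣ :=
  Units.map (inl (LaurentPolynomial ℚ) (AdjoinRoot f) : LaurentPolynomial ℚ →* LaurentProd f)
    laurentX

theorem coe_prodX : (prodX f : LaurentProd f) =
    inl (LaurentPolynomial ℚ) (AdjoinRoot f) (LaurentPolynomial.T 1) := rfl

variable (f) in
/-- The root of `f` in the free product. -/
def prodRoot : LaurentProd f := inr (LaurentPolynomial ℚ) (AdjoinRoot f) (AdjoinRoot.root f)

theorem aeval_prodRoot : aeval (prodRoot f) f = 0 := by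
  rw [prodRoot, aeval_algHom_apply, AdjoinRoot.aeval_eq, AdjoinRoot.mk_self, map_zero]

theorem laurentProd_hom_ext {φ ψ : LaurentProd f →ₐ[ℚ] D} (hx : φ (prodX f) = ψ (prodX f))
    (ht : φ (prodRoot f) = ψ (prodRoot f)) : φ = ψ :=
  freeProd_hom_ext (laurent_hom_ext hx) (AdjoinRoot.algHom_ext ht)

variable (f) in
/-- The homomorphism `R_f → ℚ[x, x⁻¹] ∗ ℚ[t] / ⟨f⟩` with `y ↦ x` and `ȳ ↦ x⁻¹ t`. -/
def toLaurentProd : PolyRing f →ₐ[ℚ] LaurentProd f :=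
  have h : aeval ((prodX f : LaurentProd f) * (↑(prodX f)⁻¹ * prodRoot f)) f = 0 := by
    rw [Units.mul_inv_cancel_left, aeval_prodRoot]
  -- The second relation is conjugate to the first: `x f(x⁻¹ t x) = f(t) x = 0`.
  polyRingLift f (prodX f) (↑(prodX f)⁻¹ * prodRoot f) h (by
    rw [← (prodX f).mul_right_inj, mul_aeval_mul, h, zero_mul, mul_zero])

/-- The homomorphism `ℚ[x, x⁻¹] ∗ ℚ[t] / ⟨f⟩ → R_f` with `x ↦ y` and `t ↦ y ȳ`. -/
def ofLaurentProd (hf : f.coeff 0 ≠ 0) : LaurentProd f →ₐ[ℚ] PolyRing f :=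
  prodLift (laurentLift (isUnit_genY hf).unit) (rootLift f _ (aeval_genY_mul f))

theorem ofLaurentProd_prodX (hf : f.coeff 0 ≠ 0) : ofLaurentProd hf (prodX f) = genY f := by
  simp [ofLaurentProd, coe_prodX]

theorem ofLaurentProd_prodRoot (hf : f.coeff 0 ≠ 0) :
    ofLaurentProd hf (prodRoot f) = genY f * genYBar f := by
  simp [ofLaurentProd, prodRoot]

/-- The isomorphism between `R_f` and the free product of `ℚ[x, x⁻¹]` and `ℚ[t] / ⟨f⟩`. -/
def polyRingEquiv (hf : f.coeff 0 ≠ 0) : PolyRing f ≃ₐ[ℚ] LaurentProd f :=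
  AlgEquiv.ofAlgHom (toLaurentProd f) (ofLaurentProd hf)
    (laurentProd_hom_ext
      (by simp [ofLaurentProd_prodX, toLaurentProd])
      (by simp [ofLaurentProd_prodRoot, toLaurentProd]))
    (polyRing_hom_ext
      (by simp [ofLaurentProd_prodX, toLaurentProd])
      (by
        have hinv : ofLaurentProd hf ↑(prodX f)⁻¹ = ↑(isUnit_genY hf).unit⁻¹ := by
          refine Units.eq_inv_of_mul_eq_one_right (u := (isUnit_genY hf).unit) ?_
          rw [IsUnit.unit_spec, ← ofLaurentProd_prodX hf, ← map_mul, Units.inv_mul, map_one]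
        simp only [AlgHom.comp_apply, toLaurentProd, polyRingLift_genYBar, map_mul, hinv,
          ofLaurentProd_prodRoot, AlgHom.id_apply]
        rw [← mul_assoc, IsUnit.val_inv_mul, one_mul]))

/-- The universal property yields a map into the generated subalgebra whose composite with the
inclusion fixes the generators, hence is the identity. -/
theorem adjoin_laurentProd : Algebra.adjoin ℚ
    (Set.range (inr (LaurentPolynomial ℚ) (AdjoinRoot f)) ∪ {↑(prodX f), ↑(prodX f)⁻¹}) = ⊤ := by
  set S := Algebra.adjoin ℚ
    (Set.range (inr (LaurentPolynomial ℚ) (AdjoinRoot f)) ∪ {↑(prodX f), ↑(prodX f)⁻¹})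
  let v : Sˣ :=
    { val := ⟨prodX f, Algebra.subset_adjoin (by simp)⟩
      inv := ⟨↑(prodX f)⁻¹, Algebra.subset_adjoin (by simp)⟩
      val_inv := Subtype.ext (prodX f).mul_inv
      inv_val := Subtype.ext (prodX f).inv_mul }
  let Φ : LaurentProd f →ₐ[ℚ] S := prodLift (D := S) (laurentLift (D := S) v)
    ((inr (LaurentPolynomial ℚ) (AdjoinRoot f)).codRestrict S
      fun k => Algebra.subset_adjoin (Or.inl ⟨k, rfl⟩))
  have hΦ : S.val.comp Φ = AlgHom.id ℚ _ := laurentProd_hom_ext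
    (by simp [Φ, coe_prodX, v]) (by simp [Φ, prodRoot])
  refine eq_top_iff.2 fun a _ => ?_
  have h : (Φ a : LaurentProd f) = a := DFunLike.congr_fun hΦ a
  exact h ▸ (Φ a).2

theorem isDomain_laurentProd (hf : Irreducible f) : IsDomain (LaurentProd f) := by
  have : Fact (Irreducible f) := ⟨hf⟩
  let pb := AdjoinRoot.powerBasis hf.ne_zero
  let i₀ : Fin pb.dim := ⟨0, pb.dim_pos⟩
  refine isDomain_of_action (b := pb.basis) (i₀ := i₀)
    (κ := inr (LaurentPolynomial ℚ) (AdjoinRoot f)) (u := prodX f)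
    (ρ := prodLift (laurentLift (onePlusUnit ℚ (AdjoinRoot f) i₀)) (leftAct pb.basis))
    (fun k => prodLift_inr _ _ k) ?_ ?_ adjoin_laurentProd
  · refine (prodLift_inl _ _ (LaurentPolynomial.T 1)).trans ?_
    rw [laurentLift_T, zpow_one, coe_onePlusUnit]
    rfl
  · rw [pb.basis_eq_pow, pow_zero]

theorem isDomain_polyRing (hf : Irreducible f) (hf0 : f.coeff 0 ≠ 0) : IsDomain (PolyRing f) :=
  have := isDomain_laurentProd hf
  (polyRingEquiv hf0).toMulEquiv.isDomain

theorem isStrictFreeProd_laurent (hf : f.natDegree ≠ 0) :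
    IsStrictFreeProd (LaurentPolynomial ℚ) (AdjoinRoot f) := by
  have : Nontrivial (AdjoinRoot f) :=
    AdjoinRoot.nontrivial f fun h => hf (natDegree_eq_of_degree_eq_some h)
  exact isStrictFreeProd _ _

end PolyRing

/-! ### Edge rings and the polynomials `C_m` -/

section Edges

/-- The quotient of `ℚ⟨y, ȳ⟩` by the zero ideal. -/
def quotientBotEquiv : NCPoly ≃ₐ[ℚ] (⊥ : TwoSidedIdeal NCPoly).ringCon.Quotient :=
  AlgEquiv.ofBijective (RingCon.mkₐ ℚ _)
    ⟨fun _ _ h => (RingCon.eq _).1 h, RingCon.mkₐ_surjective _⟩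

theorem isIntegral_four_mul_cos_sq (m : ℕ) :
    IsIntegral ℚ (4 * Real.cos (Real.pi / m) ^ 2) := by
  have h := (Real.isIntegral_two_mul_cos_rat_mul_pi (1 / m)).pow 2
  have h2 : IsIntegral ℚ ((2 * Real.cos (((1 / m : ℚ) : ℝ) * Real.pi)) ^ 2) := h.tower_top
  convert! h2 using 1
  push_cast
  ring_nf

theorem irreducible_C (m : ℕ) : Irreducible (C m) :=
  minpoly.irreducible (isIntegral_four_mul_cos_sq m)

theorem coeff_zero_C_ne_zero {m : ℕ} (hm : 3 ≤ m) : (C m).coeff 0 ≠ 0 := by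
  refine minpoly.coeff_zero_ne_zero (isIntegral_four_mul_cos_sq m) ?_
  have hm' : (3 : ℝ) ≤ m := by exact_mod_cast hm
  have : 0 < Real.cos (Real.pi / m) := by
    refine Real.cos_pos_of_mem_Ioo ⟨?_, ?_⟩
    · have : 0 < Real.pi / m := by positivity
      linarith [Real.pi_pos]
    · exact div_lt_div_of_pos_left Real.pi_pos two_pos (by linarith)
  positivity

end Edges

end EdgeRings

end

theorem mainTheorem4 :
    (∀ f : Polynomial ℚ, f.natDegree ≠ 0 → f.coeff 0 ≠ 0 →
      EdgeRings.IsStrictFreeProd (LaurentPolynomial ℚ) (AdjoinRoot f) ∧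
      Nonempty (EdgeRings.PolyRing f ≃ₐ[ℚ]
        EdgeRings.FreeProd (LaurentPolynomial ℚ) (AdjoinRoot f)) ∧
      (Irreducible f → IsDomain (EdgeRings.PolyRing f))) ∧
    (∀ (N : ℕ) (M : CoxeterMatrix (Fin N)) (W : Type*) [Group W] (_ : CoxeterSystem M W)
      (Ypos : Set (EdgeRings.coxeterGraph M).Dart), EdgeRings.IsOrientation Ypos →
      ∀ e ∈ Ypos,
        (M e.fst e.snd = 0 → Nonempty (EdgeRings.EdgeRing M e ≃ₐ[ℚ] EdgeRings.NCPoly)) ∧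
        (M e.fst e.snd ≠ 0 →
          IsField (AdjoinRoot (EdgeRings.C (M e.fst e.snd))) ∧
          EdgeRings.IsStrictFreeProd (LaurentPolynomial ℚ)
            (AdjoinRoot (EdgeRings.C (M e.fst e.snd))) ∧
          Nonempty (EdgeRings.EdgeRing M e ≃ₐ[ℚ]
            EdgeRings.FreeProd (LaurentPolynomial ℚ)
              (AdjoinRoot (EdgeRings.C (M e.fst e.snd))))) ∧
        IsDomain (EdgeRings.EdgeRing M e)) := by
  refine ⟨fun f hf hf0 => ⟨EdgeRings.isStrictFreeProd_laurent hf,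
    ⟨EdgeRings.polyRingEquiv hf0⟩, fun hirr => EdgeRings.isDomain_polyRing hirr hf0⟩,
    fun N M W _ _ Ypos _ e _ => ?_⟩
  -- Adjacency excludes the label `2`, for which `cos (π / 2) = 0` would make the constant term
  -- vanish.
  have hadj : M e.fst e.snd = 0 ∨ 3 ≤ M e.fst e.snd := e.adj.2
  unfold EdgeRings.EdgeRing
  generalize M e.fst e.snd = m at hadj ⊢
  by_cases hm : m = 0
  · rw [EdgeRings.edgeIdeal, if_pos hm]
    exact ⟨fun _ => ⟨EdgeRings.quotientBotEquiv.symm⟩, fun h => absurd hm h,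
      EdgeRings.quotientBotEquiv.symm.toMulEquiv.isDomain⟩
  · have h0 := EdgeRings.coeff_zero_C_ne_zero (hadj.resolve_left hm)
    have hirr := EdgeRings.irreducible_C m
    have : Fact (Irreducible (EdgeRings.C m)) := ⟨hirr⟩
    rw [EdgeRings.edgeIdeal, if_neg hm]
    exact ⟨fun h => absurd h hm, fun _ => ⟨Field.toIsField _,
      EdgeRings.isStrictFreeProd_laurent hirr.natDegree_pos.ne',
      ⟨EdgeRings.polyRingEquiv h0⟩⟩, EdgeRings.isDomain_polyRing hirr h0⟩
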